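/- Let $\mathbb X,\mathbb Y,\mathbb Z$ be finite sets, let $p_0$ be a probability mass function on $\mathbb X$, and let $p_{Y,Z|X}(y,z|x)$ be a conditional probability mass function on $\mathbb Y\times\mathbb Z$ given $x\in\mathbb X$. A $(2^{nR_1},2^{nR_2},n)$ coordination code for the cascade network consists of an encoding function $i:\mathbb X^n\to\{1,\dots,\lfloor 2^{nR_1}\rfloor\}$, a recoding function $j:\{1,\dots,\lfloor 2^{nR_1}\rfloor\}\to\{1,\dots,\lfloor 2^{nR_2}\rfloor\}$, and decoding functions $y^n:\{1,\dots,\lfloor 2^{nR_1}\rfloor\}\to\mathbb Y^n$ and $z^n:\{1,\dots,\lfloor 2^{nR_2}\rfloor\}\to\mathbb Z^n$. Let $X^n$ be i.i.d. with law $p_0$, and put $Y^n=y^n(i(X^n))$ and $Z^n=z^n(j(i(X^n)))$. Write $P_{x^n,y^n,z^n}(x,y,z)=\frac1n\sum_{k=1}^n\mathbf 1\{(x_k,y_k,z_k)=(x,y,z)\}$ for the joint type of three sequences, and $\|p-q\|_{TV}=\frac12\sum|p-q|$ for the total variation distance. A triple $(R_1,R_2,\Delta)\in\mathbb R^3$ is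 called achievable if there is an $N$ such that for every $n>N$ there is a $(2^{nR_1},2^{nR_2},n)$ coordination code with $$\mathbb E\,\big\|P_{X^n,Y^n,Z^n}-p_0\,p_{Y,Z|X}\big\|_{TV}\le\Delta .$$ The rate-distortion-coordination region $R^I_{p_0}(p_{Y,Z|X})$ is the closure in $\mathbb R^3$ of the set of achievable triples. Then, for every $p_{Y,Z|X}$, the region $R^I_{p_0}(p_{Y,Z|X})$ equals the set of all $(R_1,R_2,\Delta)\in\mathbb R^3$ for which there is a conditional probability mass function $q_{\hat Y,\hat Z|X}$ on $\mathbb Y\times\mathbb Z$ given $\mathbb X$ such that $$\big\|p_0\,p_{Y,Z|X}-p_0\,q_{\hat Y,\hat Z|X}\big\|_{TV}\le\Delta,\qquad R_1\ge I(X;\hat Y,\hat Z),\qquad R_2\ge I(X;\hat Z),$$ where the mutual informations are in bits (logarithms to base 2) and are computed for $(X,\hat Y,\hat Z)$ with joint law $p_0(x)\,q_{\hat Y,\hat Z|X}(y,z|x)$. -/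

import Mathlib

noncomputable section

namespace CascadeCoordination

/-- Total variation distance `(1/2) ∑ |p - q|` between two mass functions on a finite set. -/
def tv {A : Type*} [Fintype A] (p q : A → ℝ) : ℝ :=
  (1 / 2) * ∑ a, |p a - q a|

/-- The `Δ`-neighbourhood of `p`: all probability mass functions `q` on the same finite set
whose total variation distance from `p` is at most `Δ`. -/
def deltaNeighborhood {A : Type*} [Fintype A] (Δ : ℝ) (p : A → ℝ) : Set (A → ℝ) :=
  {q | q ∈ stdSimplex ℝ A ∧ tv p q ≤ Δ}

/-- A conditional probability mass function `k (b | a) = k a b`. -/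
def IsConditionalPMF {A B : Type*} [Fintype B] (k : A → B → ℝ) : Prop :=
  ∀ a, k a ∈ stdSimplex ℝ B

/-- The joint mass function `p₀(a) k(b | a)`. -/
def joint {A B : Type*} (p₀ : A → ℝ) (k : A → B → ℝ) : A × B → ℝ :=
  fun s => p₀ s.1 * k s.1 s.2

/-- The joint type (empirical mass function) of a triple of sequences of length `n`. -/
def jointType {X Y Z : Type*} [DecidableEq X] [DecidableEq Y] [DecidableEq Z] {n : ℕ}
    (x : Fin n → X) (y : Fin n → Y) (z : Fin n → Z) : X × Y × Z → ℝ :=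
  fun s => (1 / (n : ℝ)) * ∑ k : Fin n, if (x k, y k, z k) = s then 1 else 0

/-- Mutual information, in bits, of a pair with joint probability mass function `P`.
A summand with `P (a, b) = 0` vanishes, and `P (a, b) > 0` forces both marginals to be positive. -/
def mutualInfo {A B : Type*} [Fintype A] [Fintype B] (P : A × B → ℝ) : ℝ :=
  ∑ a, ∑ b, P (a, b) * Real.logb 2 (P (a, b) / ((∑ b', P (a, b')) * (∑ a', P (a', b))))

/-- The marginal of `(X, Z)` when `(X, Y, Z)` has mass function `P`. -/
def marginalXZ {X Y Z : Type*} [Fintype Y] (P : X × Y × Z → ℝ) : X × Z → ℝ :=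
  fun s => ∑ y, P (s.1, y, s.2)

/-- A coordination code of block length `n` for the cascade network, with `M₁` messages on the
first link and `M₂` messages on the second link. -/
structure CoordinationCode (X Y Z : Type*) (M₁ M₂ n : ℕ) where
  /-- the encoding function at the first node -/
  enc : (Fin n → X) → Fin M₁
  /-- the recoding function at the second node -/
  recode : Fin M₁ → Fin M₂
  /-- the decoding function at the second node -/
  decY : Fin M₁ → Fin n → Y
  /-- the decoding function at the third node -/
  decZ : Fin M₂ → Fin n → Z

/-- The number of integers in `{1, …, 2 ^ (n R)}`. -/
def messageCount (n : ℕ) (R : ℝ) : ℕ :=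
  ⌊(2 : ℝ) ^ ((n : ℝ) * R)⌋₊

/-- The expected total variation distance between the joint type of `(Xⁿ, Yⁿ, Zⁿ)` and the
mass function `P`, when `Xⁿ` is i.i.d. with mass function `p₀` and `Yⁿ`, `Zⁿ` are the functions
of `Xⁿ` produced by the code. -/
def expectedDistortion {X Y Z : Type*} [Fintype X] [Fintype Y] [Fintype Z]
    [DecidableEq X] [DecidableEq Y] [DecidableEq Z] {M₁ M₂ n : ℕ}
    (p₀ : X → ℝ) (P : X × Y × Z → ℝ) (c : CoordinationCode X Y Z M₁ M₂ n) : ℝ :=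
  ∑ x : Fin n → X, (∏ k, p₀ (x k)) *
    tv (jointType x (c.decY (c.enc x)) (c.decZ (c.recode (c.enc x)))) P

/-- `p₀(x) p(y, z | x)` is achievable for `Δ`-empirical coordination with rates `(R₁, R₂)`. -/
def Achievable {X Y Z : Type*} [Fintype X] [Fintype Y] [Fintype Z]
    [DecidableEq X] [DecidableEq Y] [DecidableEq Z]
    (p₀ : X → ℝ) (p : X → Y × Z → ℝ) (R₁ R₂ Δ : ℝ) : Prop :=
  ∃ N : ℕ, ∀ n : ℕ, N < n →
    ∃ c : CoordinationCode X Y Z (messageCount n R₁) (messageCount n R₂) n,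
      expectedDistortion p₀ (joint p₀ p) c ≤ Δ

/-- The rate-distortion-coordination region: the closure in `ℝ³` of the achievable triples
`(R₁, R₂, Δ)`. -/
def rateDistortionRegion {X Y Z : Type*} [Fintype X] [Fintype Y] [Fintype Z]
    [DecidableEq X] [DecidableEq Y] [DecidableEq Z]
    (p₀ : X → ℝ) (p : X → Y × Z → ℝ) : Set (ℝ × ℝ × ℝ) :=
  closure {t | Achievable p₀ p t.1 t.2.1 t.2.2}

end CascadeCoordination

end

namespace CascadeCoordination

open Finset Real

/-! Converse: average the joint type of source and outputs over the source law, at a single block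
length. The result has first marginal `p₀`, so it is `joint p₀ q` for some channel `q`. Convexity of
total variation bounds its distance from the target by the expected distortion. A change of measure
(`mutualInfo_averageType_le`) bounds each mutual information by the logarithm of the number of
messages divided by `n`. Hence every achievable triple already lies in the test-channel region. That
region is closed (`isClosed_testChannelRegion`), because channels form a compact set and mutual
information is continuous on nonnegative functions, so the closure adds nothing.

Achievability: for a channel `q`, use superposition coding. About `2 ^ (n I(X;Z))` words `z`, each
carrying about `2 ^ (n I(X;Y|Z))` words `y`, cover almost every source sequence by a triple whose
type is close to `joint p₀ q`. The second link carries only the index of `z`; the first carries both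
indices, and the two exponents add up to `I(X;Y,Z)`. Random choice of codebooks is replaced by
averaging in `exists_covering`, applied once per layer in `exists_superposition_covering`; the weak
law of large numbers makes the atypical weight vanish. The triangle inequality passes from `q` to
the target `p`, and the closure absorbs the strict slack in all three coordinates. -/

/-- The empirical mass function of a sequence of length `n`. -/
noncomputable def empirical {S : Type*} [DecidableEq S] {n : ℕ} (s : Fin n → S) : S → ℝ :=
  fun a => (1 / (n : ℝ)) * ∑ k : Fin n, if s k = a then 1 else 0

/-! ### Product laws, averaging over codebooks, and covering. -/

lemma sum_pi_prod {ι S : Type*} [Fintype ι] [DecidableEq ι] [Fintype S] (F : ι → S → ℝ) :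
    ∑ s : ι → S, ∏ k, F k (s k) = ∏ k, ∑ a, F k a := by
  rw [Finset.prod_univ_sum, Fintype.piFinset_univ]

lemma prod_mem_stdSimplex {S : Type*} [Fintype S] {P : S → ℝ} (hP : P ∈ stdSimplex ℝ S) (n : ℕ) :
    (fun s : Fin n → S => ∏ k, P (s k)) ∈ stdSimplex ℝ (Fin n → S) := by
  refine ⟨fun s => prod_nonneg fun k _ => hP.1 _, ?_⟩
  rw [sum_pi_prod (fun _ a => P a), prod_eq_one fun _ _ => hP.2]

lemma exists_le_of_sum_mul_le {S : Type*} [Fintype S] {w f : S → ℝ} (hw : w ∈ stdSimplex ℝ S)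
    {r : ℝ} (h : ∑ s, w s * f s ≤ r) : ∃ s, f s ≤ r := by
  by_contra! hr
  have h1 : ∑ s, w s * (f s - r) ≤ 0 := by
    simp only [mul_sub, sum_sub_distrib, ← sum_mul, hw.2]
    linarith
  have h0 : ∀ s ∈ univ, 0 ≤ w s * (f s - r) := fun s _ =>
    mul_nonneg (hw.1 s) (by linarith [hr s])
  have h2 := (sum_eq_zero_iff_of_nonneg h0).1 (le_antisymm h1 (sum_nonneg h0))
  have h3 : ∀ s, w s = 0 := fun s =>
    (mul_eq_zero.1 (h2 s (mem_univ s))).resolve_right (by linarith [hr s])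
  have := hw.2
  simp [h3] at this

/-- Convexity of `exp` on the segment from `0` to `-c`. In the covering bound this separates the
failure of typicality, `1 - t`, from the failure of a large codebook. -/
lemma exp_neg_mul_le {c t : ℝ} (h0 : 0 ≤ t) (h1 : t ≤ 1) :
    exp (-(c * t)) ≤ 1 - t + t * exp (-c) := by
  have := convexOn_exp.2 (Set.mem_univ (0 : ℝ)) (Set.mem_univ (-c)) (sub_nonneg.2 h1) h0 (by ring)
  simp only [smul_eq_mul, mul_zero, zero_add, exp_zero, mul_one] at this
  rwa [show c * t = t * c by ring, ← mul_neg]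

open Classical in
/-- **One-shot covering.** If the joint weight `P` has density at most `L` on the good set `S` with
respect to its first marginal times `b`, some codebook of `M` words fails to cover only a small
weight. -/
lemma exists_covering {A B : Type*} [Fintype A] [Fintype B] {P : A → B → ℝ}
    (hP : ∀ x z, 0 ≤ P x z) {b : B → ℝ} (hb : b ∈ stdSimplex ℝ B) {S : A → B → Prop} {L : ℝ}
    (hL : 0 < L) (hS : ∀ x z, S x z → P x z ≤ L * (∑ z', P x z') * b z) (M : ℕ) :
    ∃ c : Fin M → B, ∑ x, (∑ z, P x z) * (if ∃ j, S x (c j) then 0 else 1) ≤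
      ∑ x, ∑ z, P x z * (if S x z then 0 else 1) + (∑ x, ∑ z, P x z) * exp (-(M / L)) := by
  refine exists_le_of_sum_mul_le (prod_mem_stdSimplex hb M) ?_
  -- Failure of the whole codebook is a product of failures of its words, so averaging over
  -- independent words gives a power.
  have hind : ∀ (c : Fin M → B) (x : A),
      (if ∃ j, S x (c j) then (0 : ℝ) else 1) = ∏ j, if S x (c j) then 0 else 1 := by
    intro c x
    split_ifs with h
    · obtain ⟨j, hj⟩ := h
      exact (prod_eq_zero (mem_univ j) (by simp [hj])).symm
    · push Not at h
      simp [h]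
  have hswap : ∑ c : Fin M → B, (∏ k, b (c k)) *
        ∑ x, (∑ z, P x z) * (if ∃ j, S x (c j) then 0 else 1) =
      ∑ x, (∑ z, P x z) * (∑ z, b z * if S x z then 0 else 1) ^ M := by
    simp_rw [mul_sum]
    rw [sum_comm]
    refine sum_congr rfl fun x _ => ?_
    have : (∑ z, b z * if S x z then (0 : ℝ) else 1) ^ M =
        ∑ c : Fin M → B, ∏ j, (b (c j) * if S x (c j) then 0 else 1) := by
      rw [sum_pi_prod (fun _ z => b z * if S x z then (0 : ℝ) else 1)]
      simp
    rw [this, mul_sum]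
    refine sum_congr rfl fun c _ => ?_
    rw [hind, prod_mul_distrib]
    ring
  rw [hswap, sum_mul, ← sum_add_distrib]
  refine sum_le_sum fun x _ => ?_
  set a := ∑ z, P x z with ha
  have ha0 : 0 ≤ a := sum_nonneg fun z _ => hP x z
  rcases ha0.eq_or_lt with h0 | hpos
  · rw [← h0]
    simp only [zero_mul, add_zero]
    exact sum_nonneg fun z _ => mul_nonneg (hP x z) (by split_ifs <;> norm_num)
  -- `u` is the chance that one random word misses `x`; `t` is the conditional probability of the
  -- good set given `x` under `P`.
  set u := ∑ z, b z * (if S x z then (0 : ℝ) else 1) with hu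
  set t := (∑ z, P x z * (if S x z then (1 : ℝ) else 0)) / a with ht
  have hu0 : 0 ≤ u := sum_nonneg fun z _ => mul_nonneg (hb.1 z) (by split_ifs <;> norm_num)
  have hfail : ∑ z, P x z * (if S x z then (0 : ℝ) else 1) = a * (1 - t) := by
    rw [mul_sub, mul_one, ht, mul_div_cancel₀ _ hpos.ne', ha, ← sum_sub_distrib]
    exact sum_congr rfl fun z _ => by split_ifs <;> ring
  have ht0 : 0 ≤ t :=
    div_nonneg (sum_nonneg fun z _ => mul_nonneg (hP x z) (by split_ifs <;> norm_num)) ha0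
  have ht1 : t ≤ 1 := by
    rw [ht, div_le_one hpos]
    exact sum_le_sum fun z _ => by split_ifs <;> simp [hP x z]
  -- Change of measure: a density at most `L` on the good set means that `b` gives this set at least
  -- a fraction `1 / L` of its conditional probability.
  have hut : t / L ≤ 1 - u := by
    have h1 : 1 - u = ∑ z, b z * (if S x z then (1 : ℝ) else 0) := by
      have h2 : ∑ z, b z * (if S x z then (1 : ℝ) else 0) + u = ∑ z, b z := by
        rw [hu, ← sum_add_distrib]
        exact sum_congr rfl fun z _ => by split_ifs <;> ring
      rw [hb.2] at h2
      linarith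
    rw [h1, div_le_iff₀ hL, ht, div_le_iff₀ hpos, sum_mul, sum_mul]
    refine sum_le_sum fun z _ => ?_
    split_ifs with h
    · linarith [hS x z h]
    · simp
  have hpow : u ^ M ≤ 1 - t + exp (-(M / L)) := by
    have h1 : u ≤ exp (-(t / L)) := by linarith [add_one_le_exp (-(t / L))]
    calc u ^ M ≤ exp (-(t / L)) ^ M := pow_le_pow_left₀ hu0 h1 M
      _ = exp (-(M / L * t)) := by rw [← exp_nat_mul]; congr 1; ring
      _ ≤ 1 - t + t * exp (-(M / L)) := exp_neg_mul_le ht0 ht1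
      _ ≤ 1 - t + exp (-(M / L)) := by
        gcongr
        exact mul_le_of_le_one_left (exp_pos _).le ht1
  rw [hfail, ← mul_add]
  exact mul_le_mul_of_nonneg_left hpow ha0

open Classical in
/-- Two-layer covering: a codebook for the third coordinate and, for each of its words, a codebook
for the second coordinate. -/
lemma exists_superposition_covering {U V W : Type*} [Fintype U] [Fintype V] [Fintype W]
    {P : U → V → W → ℝ} (hP : ∀ u v w, 0 ≤ P u v w) (hsum : ∑ u, ∑ v, ∑ w, P u v w = 1)
    {S : U → V → W → Prop} {L₁ L₂ : ℝ} (hL₁ : 0 < L₁) (hL₂ : 0 < L₂)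
    (h₁ : ∀ u v w, S u v w →
      P u v w * (∑ u', ∑ v', P u' v' w) ≤ L₁ * (∑ v', P u v' w) * ∑ u', P u' v w)
    (h₂ : ∀ u v w, S u v w →
      ∑ v', P u v' w ≤ L₂ * (∑ v', ∑ w', P u v' w') * ∑ u', ∑ v', P u' v' w)
    (K M : ℕ) (hV : Nonempty V) :
    ∃ (cz : Fin M → W) (cy : W → Fin K → V),
      ∑ u, (∑ v, ∑ w, P u v w) * (if ∃ j k, S u (cy (cz j) k) (cz j) then 0 else 1) ≤
        ∑ u, ∑ v, ∑ w, P u v w * (if S u v w then 0 else 1) +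
          exp (-(K / L₁)) + exp (-(M / L₂)) := by
  have hcy : ∀ w, ∃ c : Fin K → V,
      ∑ u, (∑ v, P u v w) * (if ∃ k, S u (c k) w then 0 else 1) ≤
        ∑ u, ∑ v, P u v w * (if S u v w then 0 else 1) +
          (∑ u, ∑ v, P u v w) * exp (-(K / L₁)) := by
    intro w
    have hw0 : 0 ≤ ∑ u, ∑ v, P u v w := sum_nonneg fun u _ => sum_nonneg fun v _ => hP u v w
    -- A word `w` of weight zero has no conditional law, but any codebook serves it; otherwise words
    -- are drawn from the law of `V` given `w`.
    rcases hw0.eq_or_lt with h0 | hpos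
    · have hz : ∀ u v, P u v w = 0 := by
        intro u v
        have h1 := (sum_eq_zero_iff_of_nonneg
          fun u _ => sum_nonneg fun v _ => hP u v w).1 h0.symm u (mem_univ u)
        exact (sum_eq_zero_iff_of_nonneg fun v _ => hP u v w).1 h1 v (mem_univ v)
      exact ⟨fun _ => Classical.arbitrary V, by simp [hz]⟩
    · refine exists_covering (P := fun u v => P u v w)
        (b := fun v => (∑ u, P u v w) / ∑ u, ∑ v, P u v w) (S := fun u v => S u v w)
        (fun u v => hP u v w) ⟨fun v => ?_, ?_⟩ hL₁ (fun u v h => ?_) K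
      · exact div_nonneg (sum_nonneg fun u _ => hP u v w) hw0
      · rw [← sum_div, sum_comm, div_self hpos.ne']
      · rw [mul_div_assoc', le_div_iff₀ hpos]
        exact h₁ u v w h
  choose cy hcy using hcy
  have hmw : (fun w => ∑ u, ∑ v, P u v w) ∈ stdSimplex ℝ W := by
    refine ⟨fun w => sum_nonneg fun u _ => sum_nonneg fun v _ => hP u v w, ?_⟩
    rw [← hsum, sum_comm]
    exact sum_congr rfl fun u _ => sum_comm
  -- In the outer layer `w` is good for `u` when its own inner codebook covers `u`. The weight of
  -- bad pairs is then exactly the total inner failure, bounded by summing `hcy`.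
  obtain ⟨cz, hcz⟩ := exists_covering (P := fun u w => ∑ v, P u v w)
    (b := fun w => ∑ u, ∑ v, P u v w) (S := fun u w => ∃ k, S u (cy w k) w)
    (fun u w => sum_nonneg fun v _ => hP u v w) hmw hL₂
    (fun u w ⟨k, hk⟩ => by
      have := h₂ u _ w hk
      rwa [sum_comm (s := univ (α := V))] at this) M
  refine ⟨cz, cy, ?_⟩
  have e1 : ∀ u, ∑ w, ∑ v, P u v w = ∑ v, ∑ w, P u v w := fun u => sum_comm
  simp_rw [e1, hsum, one_mul] at hcz
  refine (le_of_eq (sum_congr rfl fun u _ => by congr)).trans (hcz.trans ?_)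
  have h3 := sum_le_sum fun w (_ : w ∈ univ) => hcy w
  rw [sum_add_distrib, ← sum_mul, hmw.2, one_mul, sum_comm (s := univ (α := W))] at h3
  have e2 : ∑ w, ∑ u, ∑ v, P u v w * (if S u v w then (0 : ℝ) else 1) =
      ∑ u, ∑ v, ∑ w, P u v w * (if S u v w then 0 else 1) := by
    rw [sum_comm]
    exact sum_congr rfl fun u _ => sum_comm
  rw [e2] at h3
  convert add_le_add_left h3 (exp (-(M / L₂)))

/-! ### Total variation distance. -/

lemma tv_nonneg {A : Type*} [Fintype A] (p q : A → ℝ) : 0 ≤ tv p q :=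
  mul_nonneg (by norm_num) (sum_nonneg fun _ _ => abs_nonneg _)

lemma tv_comm {A : Type*} [Fintype A] (p q : A → ℝ) : tv p q = tv q p := by
  simp only [tv, abs_sub_comm]

lemma tv_triangle {A : Type*} [Fintype A] (p q r : A → ℝ) : tv p r ≤ tv p q + tv q r := by
  simp only [tv]
  rw [← mul_add, ← sum_add_distrib]
  gcongr
  exact abs_sub_le _ _ _

lemma tv_le_one {A : Type*} [Fintype A] {p q : A → ℝ} (hp : p ∈ stdSimplex ℝ A)
    (hq : q ∈ stdSimplex ℝ A) : tv p q ≤ 1 := by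
  have : ∑ a, |p a - q a| ≤ ∑ a, (p a + q a) := sum_le_sum fun a _ => by
    rw [abs_le]
    constructor <;> linarith [hp.1 a, hq.1 a]
  rw [sum_add_distrib, hp.2, hq.2] at this
  simp only [tv]
  linarith

lemma sum_mul_sub_le_tv {A : Type*} [Fintype A] (p q φ : A → ℝ) :
    ∑ a, p a * φ a ≤ ∑ a, q a * φ a + 2 * tv p q * ∑ a, |φ a| := by
  have : ∑ a, (p a - q a) * φ a ≤ (∑ a, |p a - q a|) * ∑ a, |φ a| := by
    rw [sum_mul]
    refine sum_le_sum fun a _ => (le_abs_self _).trans ?_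
    rw [abs_mul]
    gcongr
    exact single_le_sum (f := fun a => |φ a|) (fun _ _ => abs_nonneg _) (mem_univ a)
  simp only [sub_mul, sum_sub_distrib] at this
  simp only [tv]
  linarith

/-! ### Empirical mass functions and the weak law of large numbers. -/

section empirical

variable {S : Type*} {n : ℕ}

lemma empirical_nonneg [DecidableEq S] (s : Fin n → S) (a : S) : 0 ≤ empirical s a := by
  unfold empirical
  refine mul_nonneg (by positivity) (sum_nonneg fun k _ => ?_)
  split_ifs <;> norm_num

lemma sum_empirical_mul [DecidableEq S] [Fintype S] (s : Fin n → S) (φ : S → ℝ) :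
    ∑ a, empirical s a * φ a = (1 / (n : ℝ)) * ∑ k, φ (s k) := by
  simp only [empirical, mul_assoc, ← mul_sum, sum_mul]
  rw [sum_comm]
  simp

lemma empirical_mem_stdSimplex [DecidableEq S] [Fintype S] (hn : 0 < n) (s : Fin n → S) :
    empirical s ∈ stdSimplex ℝ S := by
  refine ⟨empirical_nonneg s, ?_⟩
  have := sum_empirical_mul s fun _ => 1
  have hn' : (n : ℝ) ≠ 0 := by positivity
  simpa [hn'] using this

lemma empirical_apply_pos [DecidableEq S] (s : Fin n → S) (k : Fin n) : 0 < empirical s (s k) := by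
  have hn : 0 < n := k.pos
  unfold empirical
  refine mul_pos (by positivity) (sum_pos' (fun j _ => ?_) ⟨k, mem_univ k, by simp⟩)
  split_ifs <;> norm_num

lemma sum_prod_mul_coord [Fintype S] {P : S → ℝ} (hP : P ∈ stdSimplex ℝ S) (k : Fin n) (h : S → ℝ) :
    ∑ s : Fin n → S, (∏ m, P (s m)) * h (s k) = ∑ a, P a * h a := by
  have h1 : ∀ s : Fin n → S, (∏ m, P (s m)) * h (s k) =
      ∏ m, (P (s m) * if m = k then h (s m) else 1) := fun s => by
    rw [prod_mul_distrib]; simp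
  simp_rw [h1]
  rw [sum_pi_prod (fun m a => P a * if m = k then h a else 1),
    prod_eq_single k (fun m _ hm => by simp [hm, hP.2]) (by simp)]
  simp

lemma sum_prod_mul_coord_mul_coord [Fintype S] {P : S → ℝ} {g : S → ℝ} (hg : ∑ a, P a * g a = 0)
    {k l : Fin n} (hkl : k ≠ l) :
    ∑ s : Fin n → S, (∏ m, P (s m)) * (g (s k) * g (s l)) = 0 := by
  have h1 : ∀ s : Fin n → S, (∏ m, P (s m)) * (g (s k) * g (s l)) =
      ∏ m, (P (s m) * ((if m = k then g (s m) else 1) * if m = l then g (s m) else 1)) :=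
    fun s => by rw [prod_mul_distrib, prod_mul_distrib]; simp
  simp_rw [h1]
  rw [sum_pi_prod (fun m a => P a * ((if m = k then g a else 1) * if m = l then g a else 1))]
  exact prod_eq_zero (mem_univ k) (by simpa [hkl] using hg)

/-- Additivity of variance: the cross terms vanish by independence and centring. -/
lemma sum_prod_mul_sq_sum [Fintype S] {P : S → ℝ} (hP : P ∈ stdSimplex ℝ S) {g : S → ℝ}
    (hg : ∑ a, P a * g a = 0) :
    ∑ s : Fin n → S, (∏ m, P (s m)) * (∑ k, g (s k)) ^ 2 = n * ∑ a, P a * g a ^ 2 := by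
  simp_rw [sq, sum_mul_sum, mul_sum]
  rw [sum_comm]
  have : ∀ k : Fin n, ∑ s : Fin n → S, ∑ l, (∏ m, P (s m)) * (g (s k) * g (s l)) =
      ∑ a, P a * (g a * g a) := by
    intro k
    rw [sum_comm, sum_eq_single k
      (fun l _ hl => sum_prod_mul_coord_mul_coord hg hl.symm) (by simp)]
    exact sum_prod_mul_coord hP k fun a => g a * g a
  simp_rw [this]
  simp [mul_sum]

lemma sum_prod_mul_abs_empirical_sub_le [DecidableEq S] [Fintype S] (hn : 0 < n)
    {P : S → ℝ} (hP : P ∈ stdSimplex ℝ S) (a : S) :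
    ∑ s : Fin n → S, (∏ m, P (s m)) * |empirical s a - P a| ≤ 1 / √n := by
  have hn' : (0 : ℝ) < n := by positivity
  have hr : 0 < √(n : ℝ) := sqrt_pos.2 hn'
  have hrr : √(n : ℝ) * √n = n := mul_self_sqrt hn'.le
  set g : S → ℝ := fun b => (if b = a then 1 else 0) - P a with hgdef
  have hg : ∑ b, P b * g b = 0 := by
    simp [hgdef, mul_sub, ← sum_mul, hP.2]
  have hPa : P a ≤ 1 := by
    rw [← hP.2]; exact single_le_sum (fun b _ => hP.1 b) (mem_univ a)
  have hg1 : ∑ b, P b * g b ^ 2 ≤ 1 := by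
    rw [← hP.2]
    refine sum_le_sum fun b _ => mul_le_of_le_one_right (hP.1 b) ?_
    rw [sq_le_one_iff_abs_le_one, abs_le]
    simp only [hgdef]
    split_ifs <;> constructor <;> linarith [hP.1 a]
  have hdev : ∀ s : Fin n → S, empirical s a - P a = (1 / (n : ℝ)) * ∑ k, g (s k) := by
    intro s
    simp only [hgdef, sum_sub_distrib, empirical, sum_const, card_univ, Fintype.card_fin,
      nsmul_eq_mul]
    field_simp
  -- The inequality `2 y ≤ √n y² + 1 / √n` turns the second-moment bound into a first-moment bound;
  -- the weight `√n` balances the two terms.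
  have hpt : ∀ s : Fin n → S, |empirical s a - P a| ≤
      (√n * (1 / (n : ℝ)) ^ 2 / 2) * (∑ k, g (s k)) ^ 2 + 1 / √n / 2 := by
    intro s
    have h1 : (√n * (1 / (n : ℝ)) ^ 2 / 2) * (∑ k, g (s k)) ^ 2 =
        √n / 2 * |empirical s a - P a| ^ 2 := by rw [sq_abs, hdev]; ring
    rw [h1]
    set y := |empirical s a - P a|
    have h2 : √n / 2 * y ^ 2 + 1 / √n / 2 - y = (√n * y - 1) ^ 2 / (2 * √n) := by
      field_simp; ring
    have h3 : 0 ≤ (√n * y - 1) ^ 2 / (2 * √n) := by positivity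
    linarith
  calc _ ≤ ∑ s : Fin n → S, (∏ m, P (s m)) *
          ((√n * (1 / (n : ℝ)) ^ 2 / 2) * (∑ k, g (s k)) ^ 2 + 1 / √n / 2) :=
        sum_le_sum fun s _ =>
          mul_le_mul_of_nonneg_left (hpt s) (prod_nonneg fun m _ => hP.1 _)
    _ = (√n * (1 / (n : ℝ)) ^ 2 / 2) * (n * ∑ b, P b * g b ^ 2) + 1 / √n / 2 := by
        rw [← sum_prod_mul_sq_sum hP hg, mul_sum]
        simp only [mul_add, sum_add_distrib, ← sum_mul]
        rw [(prod_mem_stdSimplex hP n).2, one_mul]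
        congr 1
        exact sum_congr rfl fun s _ => by ring
    _ ≤ (√n * (1 / (n : ℝ)) ^ 2 / 2) * (n * 1) + 1 / √n / 2 := by gcongr
    _ = 1 / √n := by
        have : √(n : ℝ) * (1 / (n : ℝ)) ^ 2 / 2 * (n * 1) = 1 / √n / 2 := by
          field_simp
          rw [sq, hrr]
        rw [this]; ring

lemma sum_prod_mul_tv_empirical_le [DecidableEq S] [Fintype S] (hn : 0 < n)
    {P : S → ℝ} (hP : P ∈ stdSimplex ℝ S) :
    ∑ s : Fin n → S, (∏ m, P (s m)) * tv (empirical s) P ≤ Fintype.card S / √n := by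
  simp only [tv, mul_sum]
  rw [sum_comm]
  calc _ ≤ ∑ _a : S, 1 / √(n : ℝ) := sum_le_sum fun a _ => by
        have h1 := sum_prod_mul_abs_empirical_sub_le hn hP a
        have h0 : 0 ≤ 1 / √(n : ℝ) := by positivity
        have : ∑ s : Fin n → S, (∏ m, P (s m)) * (1 / 2 * |empirical s a - P a|) =
            1 / 2 * ∑ s : Fin n → S, (∏ m, P (s m)) * |empirical s a - P a| := by
          rw [mul_sum]; exact sum_congr rfl fun s _ => by ring
        rw [this]; linarith
    _ = _ := by simp [div_eq_mul_inv]

end empirical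

/-! ### Gibbs' inequality and mutual information. -/

/-- Gibbs' inequality. -/
lemma sum_mul_log_div_nonneg {S : Type*} [Fintype S] {P Q : S → ℝ} (hP : ∀ s, 0 ≤ P s)
    (hQ : ∀ s, 0 ≤ Q s) (hPQ : ∀ s, 0 < P s → 0 < Q s) (hsum : ∑ s, Q s ≤ ∑ s, P s) :
    0 ≤ ∑ s, P s * log (P s / Q s) := by
  have : ∀ s ∈ univ, P s - Q s ≤ P s * log (P s / Q s) := by
    intro s _
    rcases (hP s).eq_or_lt with h0 | hpos
    · simp [← h0, hQ s]
    · have hq := hPQ s hpos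
      have h1 := log_le_sub_one_of_pos (div_pos hq hpos)
      rw [← inv_div, log_inv] at h1
      have h2 : P s * (Q s / P s - 1) = Q s - P s := by field_simp
      have h3 := mul_le_mul_of_nonneg_left h1 hpos.le
      rw [inv_div, h2] at h3
      linarith
  have h := sum_le_sum this
  rw [sum_sub_distrib] at h
  linarith

section mutualInfo

variable {A B : Type*} {P : A × B → ℝ}

lemma le_marginal_fst [Fintype B] (hP : ∀ s, 0 ≤ P s) (a : A) (b : B) :
    P (a, b) ≤ ∑ b', P (a, b') :=
  single_le_sum (f := fun b' => P (a, b')) (fun _ _ => hP _) (mem_univ b)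

lemma le_marginal_snd [Fintype A] (hP : ∀ s, 0 ≤ P s) (a : A) (b : B) :
    P (a, b) ≤ ∑ a', P (a', b) :=
  single_le_sum (f := fun a' => P (a', b)) (fun _ _ => hP _) (mem_univ a)

variable [Fintype A] [Fintype B]

lemma mutualInfo_mul_log_two (P : A × B → ℝ) : mutualInfo P * log 2 =
    ∑ s, P s * log (P s / ((∑ b', P (s.1, b')) * ∑ a', P (a', s.2))) := by
  have h2 : log 2 ≠ 0 := (log_pos one_lt_two).ne'
  rw [Fintype.sum_prod_type, mutualInfo, sum_mul]
  refine sum_congr rfl fun a _ => ?_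
  rw [sum_mul]
  refine sum_congr rfl fun b _ => ?_
  rw [logb]
  field_simp

lemma mutualInfo_nonneg (hP : P ∈ stdSimplex ℝ (A × B)) : 0 ≤ mutualInfo P := by
  have h2 : 0 < log 2 := log_pos one_lt_two
  refine le_of_mul_le_mul_right (a := log 2) ?_ h2
  rw [zero_mul, mutualInfo_mul_log_two]
  refine sum_mul_log_div_nonneg hP.1 (fun s => ?_) (fun s hs => ?_) ?_
  · exact mul_nonneg (sum_nonneg fun _ _ => hP.1 _) (sum_nonneg fun _ _ => hP.1 _)
  · exact mul_pos (hs.trans_le (le_marginal_fst hP.1 s.1 s.2))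
      (hs.trans_le (le_marginal_snd hP.1 s.1 s.2))
  · have h := hP.2
    have h' := h
    rw [Fintype.sum_prod_type] at h
    rw [Fintype.sum_prod_type_right] at h'
    rw [Fintype.sum_prod_type]
    simp_rw [← mul_sum, h', mul_one]
    rw [h, hP.2]

/-- The entropy form involves only `negMulLog`, which is continuous at zero, unlike the ratio inside
the logarithm; continuity of mutual information rests on it. -/
lemma mutualInfo_eq_entropy (hP : ∀ s, 0 ≤ P s) : mutualInfo P =
    (∑ a, negMulLog (∑ b, P (a, b)) + ∑ b, negMulLog (∑ a, P (a, b)) -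
      ∑ a, ∑ b, negMulLog (P (a, b))) / log 2 := by
  have h2 : log 2 ≠ 0 := (log_pos one_lt_two).ne'
  rw [eq_div_iff h2, mutualInfo_mul_log_two, Fintype.sum_prod_type]
  have hpt : ∀ a b, P (a, b) * log (P (a, b) / ((∑ b', P (a, b')) * ∑ a', P (a', b))) =
      P (a, b) * -log (∑ b', P (a, b')) + P (a, b) * -log (∑ a', P (a', b)) -
        negMulLog (P (a, b)) := by
    intro a b
    rcases (hP (a, b)).eq_or_lt with h0 | hpos
    · simp [← h0]
    · have h1 := hpos.trans_le (le_marginal_fst hP a b)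
      have h3 := hpos.trans_le (le_marginal_snd hP a b)
      rw [log_div hpos.ne' (mul_pos h1 h3).ne', log_mul h1.ne' h3.ne', negMulLog]
      ring
  simp_rw [hpt, sum_sub_distrib, sum_add_distrib, ← sum_mul]
  congr 2
  · exact sum_congr rfl fun a _ => by rw [negMulLog]; ring
  · rw [sum_comm]
    refine sum_congr rfl fun b _ => ?_
    rw [← sum_mul, negMulLog]; ring

end mutualInfo

/-! ### The single-letter converse bound. -/

section converse

variable {X B : Type*} [Fintype X] [DecidableEq X] [DecidableEq B] {n M : ℕ}

/-- The averaged joint type of an i.i.d. source sequence and a coded sequence. -/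
noncomputable def averageType (p₀ : X → ℝ) (w : (Fin n → X) → Fin n → B) : X × B → ℝ :=
  fun s => ∑ x : Fin n → X, (∏ k, p₀ (x k)) * empirical (fun k => (x k, w x k)) s

lemma sum_averageType_mul [Fintype B] (p₀ : X → ℝ) (w : (Fin n → X) → Fin n → B) (φ : X × B → ℝ) :
    ∑ s, averageType p₀ w s * φ s =
      ∑ x : Fin n → X, (∏ k, p₀ (x k)) * ((1 / (n : ℝ)) * ∑ k, φ (x k, w x k)) := by
  simp only [averageType, sum_mul]
  rw [sum_comm]
  refine sum_congr rfl fun x _ => ?_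
  rw [← sum_empirical_mul (fun k => (x k, w x k)) φ, mul_sum]
  exact sum_congr rfl fun s _ => by ring

lemma averageType_nonneg {p₀ : X → ℝ} (hp₀ : p₀ ∈ stdSimplex ℝ X) (w : (Fin n → X) → Fin n → B)
    (s : X × B) : 0 ≤ averageType p₀ w s :=
  sum_nonneg fun _ _ => mul_nonneg (prod_nonneg fun _ _ => hp₀.1 _) (empirical_nonneg _ _)

lemma sum_averageType_snd [Fintype B] {p₀ : X → ℝ} (hp₀ : p₀ ∈ stdSimplex ℝ X) (hn : 0 < n)
    (w : (Fin n → X) → Fin n → B) (a : X) : ∑ b, averageType p₀ w (a, b) = p₀ a := by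
  have h := sum_averageType_mul p₀ w fun s => if s.1 = a then 1 else 0
  rw [Fintype.sum_prod_type, sum_eq_single a (fun a' _ h' => by simp [h']) (by simp)] at h
  simp only [if_true, mul_one] at h
  rw [h]
  simp_rw [mul_sum]
  rw [sum_comm]
  have : ∀ k : Fin n, ∑ x : Fin n → X, (∏ k, p₀ (x k)) * (1 / (n : ℝ) * if x k = a then 1 else 0) =
      1 / (n : ℝ) * p₀ a := by
    intro k
    rw [sum_prod_mul_coord hp₀ k fun b => 1 / (n : ℝ) * if b = a then 1 else 0]
    simp [mul_comm]
  rw [sum_congr rfl fun k _ => this k]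
  have hn' : (n : ℝ) ≠ 0 := by positivity
  simp [hn']

lemma averageType_pos {p₀ : X → ℝ} (hp₀ : p₀ ∈ stdSimplex ℝ X) (w : (Fin n → X) → Fin n → B)
    {x : Fin n → X} (hx : 0 < ∏ k, p₀ (x k)) (k : Fin n) : 0 < averageType p₀ w (x k, w x k) :=
  sum_pos' (fun _ _ => mul_nonneg (prod_nonneg fun _ _ => hp₀.1 _) (empirical_nonneg _ _))
    ⟨x, mem_univ x, mul_pos hx (empirical_apply_pos (fun k => (x k, w x k)) k)⟩

/-- The converse of rate-distortion theory: a code with `M` messages conveys at most `log₂ M` bits,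
so its averaged joint type has mutual information at most `(log₂ M) / n`. -/
lemma mutualInfo_averageType_le [Fintype B] {p₀ : X → ℝ} (hp₀ : p₀ ∈ stdSimplex ℝ X)
    (hn : 0 < n) (f : (Fin n → X) → Fin M) (w : Fin M → Fin n → B) :
    n * mutualInfo (averageType p₀ fun x => w (f x)) ≤ logb 2 M := by
  have h2 : 0 < log 2 := log_pos one_lt_two
  have hn' : (n : ℝ) ≠ 0 := by positivity
  set P := averageType p₀ fun x => w (f x) with hPdef
  have hP0 : ∀ s, 0 ≤ P s := averageType_nonneg hp₀ _
  have hfst : ∀ a, ∑ b, P (a, b) = p₀ a := sum_averageType_snd hp₀ hn _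
  set Q : B → ℝ := fun b => ∑ a, P (a, b) with hQdef
  have hQ0 : ∀ b, 0 ≤ Q b := fun b => sum_nonneg fun _ _ => hP0 _
  have hX : Nonempty X := by
    by_contra h
    rw [not_nonempty_iff] at h
    have := hp₀.2
    simp at this
  have hM : (0 : ℝ) < M := Nat.cast_pos.2 (f fun _ => Classical.arbitrary X).pos
  rw [logb, le_div_iff₀ h2, mul_assoc, mutualInfo_mul_log_two]
  simp_rw [hfst]
  rw [sum_averageType_mul p₀ (fun x => w (f x)) fun s => log (P s / (p₀ s.1 * Q s.2)), mul_sum]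
  -- With `r` the product of the likelihood ratios, this is `log (r / M) ≤ r / M - 1` weighted by
  -- the source probability, which cancels the factors `p₀` in `r`. It remains to show that the
  -- weighted ratios sum to at most `M`.
  have hpt : ∀ x ∈ (univ : Finset (Fin n → X)),
      (n : ℝ) * ((∏ k, p₀ (x k)) * (1 / (n : ℝ) *
        ∑ k, log (P (x k, w (f x) k) / (p₀ (x k) * Q (w (f x) k))))) ≤
      (∏ k, P (x k, w (f x) k) / Q (w (f x) k)) / M + (∏ k, p₀ (x k)) * (log M - 1) := by
    intro x _
    have e : (n : ℝ) * ((∏ k, p₀ (x k)) * (1 / (n : ℝ) *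
        ∑ k, log (P (x k, w (f x) k) / (p₀ (x k) * Q (w (f x) k))))) =
        (∏ k, p₀ (x k)) * ∑ k, log (P (x k, w (f x) k) / (p₀ (x k) * Q (w (f x) k))) := by
      field_simp
    rw [e]
    rcases (prod_nonneg fun k _ => hp₀.1 (x k) : 0 ≤ ∏ k, p₀ (x k)).eq_or_lt with h0 | hpos
    · rw [← h0, zero_mul, zero_mul, add_zero]
      exact div_nonneg (prod_nonneg fun k _ => div_nonneg (hP0 _) (hQ0 _)) hM.le
    · have hpk : ∀ k, 0 < p₀ (x k) := fun k =>
        (hp₀.1 _).lt_of_ne' fun h => hpos.ne' (prod_eq_zero (mem_univ k) h)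
      have hPk : ∀ k, 0 < P (x k, w (f x) k) := fun k =>
        averageType_pos hp₀ (fun x => w (f x)) hpos k
      have hQk : ∀ k, 0 < Q (w (f x) k) := fun k => (hPk k).trans_le (le_marginal_snd hP0 _ _)
      have hrk : ∀ k, 0 < P (x k, w (f x) k) / (p₀ (x k) * Q (w (f x) k)) := fun k =>
        div_pos (hPk k) (mul_pos (hpk k) (hQk k))
      rw [← log_prod fun k _ => (hrk k).ne']
      set r := ∏ k, P (x k, w (f x) k) / (p₀ (x k) * Q (w (f x) k)) with hr
      have hr0 : 0 < r := prod_pos fun k _ => hrk k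
      have h1 := log_le_sub_one_of_pos (div_pos hr0 hM)
      rw [log_div hr0.ne' hM.ne'] at h1
      have h3 : (∏ k, p₀ (x k)) * r = ∏ k, P (x k, w (f x) k) / Q (w (f x) k) := by
        rw [hr, ← prod_mul_distrib]
        refine prod_congr rfl fun k _ => ?_
        have := (hpk k).ne'
        have := (hQk k).ne'
        field_simp
      rw [← h3, mul_div_assoc, ← mul_add]
      exact mul_le_mul_of_nonneg_left (by linarith) hpos.le
  refine (sum_le_sum hpt).trans ?_
  rw [sum_add_distrib, ← sum_mul, (prod_mem_stdSimplex hp₀ n).2, ← sum_div, one_mul]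
  -- Enlarging the sum from the message `f x` to all messages decouples `x` from the codeword. For
  -- each message the sum over `x` factors into conditional laws of the source letter, each of mass
  -- at most one.
  have hle : ∑ x : Fin n → X, ∏ k, P (x k, w (f x) k) / Q (w (f x) k) ≤ M := by
    calc _ ≤ ∑ x : Fin n → X, ∑ u, ∏ k, P (x k, w u k) / Q (w u k) :=
          sum_le_sum fun x _ => single_le_sum
            (f := fun u => ∏ k, P (x k, w u k) / Q (w u k))
            (fun u _ => prod_nonneg fun k _ => div_nonneg (hP0 _) (hQ0 _)) (mem_univ (f x))
      _ = ∑ u, ∏ k, ∑ a, P (a, w u k) / Q (w u k) := by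
          rw [sum_comm]
          exact sum_congr rfl fun u _ => sum_pi_prod fun k a => P (a, w u k) / Q (w u k)
      _ ≤ ∑ _u : Fin M, (1 : ℝ) := sum_le_sum fun u _ => prod_le_one
          (fun k _ => sum_nonneg fun a _ => div_nonneg (hP0 _) (hQ0 _)) fun k _ => by
            rw [← sum_div]; exact div_self_le_one _
      _ = M := by simp
  have := (div_le_one hM).2 hle
  linarith

end converse

/-! ### The test-channel region: closedness and the converse. -/

lemma joint_mem_stdSimplex {A B : Type*} [Fintype A] [Fintype B] {p₀ : A → ℝ}
    (hp₀ : p₀ ∈ stdSimplex ℝ A) {q : A → B → ℝ} (hq : IsConditionalPMF q) :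
    joint p₀ q ∈ stdSimplex ℝ (A × B) := by
  refine ⟨fun s => mul_nonneg (hp₀.1 _) ((hq _).1 _), ?_⟩
  rw [Fintype.sum_prod_type]
  simp only [joint, ← mul_sum, (hq _).2, mul_one, hp₀.2]

lemma messageCount_le (n : ℕ) (R : ℝ) : (messageCount n R : ℝ) ≤ 2 ^ (n * R) :=
  Nat.floor_le (by positivity)

lemma logb_messageCount_le {n : ℕ} {R : ℝ} (h : 0 < messageCount n R) :
    logb 2 (messageCount n R) ≤ n * R := by
  rw [logb_le_iff_le_rpow one_lt_two (by exact_mod_cast h)]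
  exact messageCount_le n R

lemma tv_sum_mul_le {A ι : Type*} [Fintype A] [Fintype ι] {c : ι → ℝ} (hc : c ∈ stdSimplex ℝ ι)
    (T : ι → A → ℝ) (P : A → ℝ) :
    tv (fun a => ∑ i, c i * T i a) P ≤ ∑ i, c i * tv (T i) P := by
  have : ∀ a, |(∑ i, c i * T i a) - P a| ≤ ∑ i, c i * |T i a - P a| := by
    intro a
    have e : (∑ i, c i * T i a) - P a = ∑ i, c i * (T i a - P a) := by
      simp only [mul_sub, sum_sub_distrib, ← sum_mul, hc.2, one_mul]
    rw [e]
    refine (abs_sum_le_sum_abs _ _).trans_eq (sum_congr rfl fun i _ => ?_)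
    rw [abs_mul, abs_of_nonneg (hc.1 i)]
  simp only [tv, mul_left_comm (c _), ← mul_sum]
  refine mul_le_mul_of_nonneg_left ((sum_le_sum fun a _ => this a).trans_eq ?_) (by norm_num)
  rw [sum_comm]
  simp only [mul_sum]

lemma marginalXZ_nonneg {X Y Z : Type*} [Fintype Y] {P : X × Y × Z → ℝ} (hP : ∀ s, 0 ≤ P s)
    (s : X × Z) : 0 ≤ marginalXZ P s :=
  sum_nonneg fun _ _ => hP _

section region

variable {X Y Z : Type*} [Fintype X] [Fintype Y] [Fintype Z]

/-- The triples `(R₁, R₂, Δ)` attained by some test channel `q`. -/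
def testChannelRegion (p₀ : X → ℝ) (p : X → Y × Z → ℝ) : Set (ℝ × ℝ × ℝ) :=
  {t | ∃ q : X → Y × Z → ℝ, IsConditionalPMF q ∧
    joint p₀ q ∈ deltaNeighborhood t.2.2 (joint p₀ p) ∧ mutualInfo (joint p₀ q) ≤ t.1 ∧
    mutualInfo (marginalXZ (joint p₀ q)) ≤ t.2.1}

lemma continuousOn_mutualInfo {A B : Type*} [Fintype A] [Fintype B] :
    ContinuousOn (mutualInfo (A := A) (B := B)) {P | ∀ s, 0 ≤ P s} := by
  refine ContinuousOn.congr (f := fun P : A × B → ℝ =>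
    (∑ a, negMulLog (∑ b, P (a, b)) + ∑ b, negMulLog (∑ a, P (a, b)) -
      ∑ a, ∑ b, negMulLog (P (a, b))) / log 2) ?_ fun P hP => mutualInfo_eq_entropy hP
  refine Continuous.continuousOn (Continuous.div_const (Continuous.sub (Continuous.add ?_ ?_) ?_) _)
  · exact continuous_finsetSum _ fun a _ => continuous_negMulLog.comp (by fun_prop)
  · exact continuous_finsetSum _ fun a _ => continuous_negMulLog.comp (by fun_prop)
  · exact continuous_finsetSum _ fun a _ => continuous_finsetSum _ fun b _ =>
      continuous_negMulLog.comp (by fun_prop)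

/-- The region is the projection of a closed set of pairs (channel, triple) along the compact space
of channels, and such projections are closed maps. -/
lemma isClosed_testChannelRegion {p₀ : X → ℝ} (hp₀ : p₀ ∈ stdSimplex ℝ X)
    (p : X → Y × Z → ℝ) : IsClosed (testChannelRegion p₀ p) := by
  have hK : IsCompact {q : X → Y × Z → ℝ | IsConditionalPMF q} := by
    have : {q : X → Y × Z → ℝ | IsConditionalPMF q} =
        Set.univ.pi fun _ => stdSimplex ℝ (Y × Z) := by
      ext q; simp [IsConditionalPMF]
    rw [this]
    exact isCompact_univ_pi fun _ => isCompact_stdSimplex _ _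
  have : CompactSpace {q : X → Y × Z → ℝ | IsConditionalPMF q} := isCompact_iff_compactSpace.1 hK
  have hj : Continuous fun q : {q : X → Y × Z → ℝ | IsConditionalPMF q} => joint p₀ q.1 := by
    refine continuous_pi fun s => ?_
    exact continuous_const.mul ((continuous_apply s.2).comp
      ((continuous_apply s.1).comp continuous_subtype_val))
  have hj0 : ∀ (q : {q : X → Y × Z → ℝ | IsConditionalPMF q}) (s), 0 ≤ joint p₀ q.1 s :=
    fun q => (joint_mem_stdSimplex hp₀ q.2).1
  have hI₁ : Continuous fun q : {q : X → Y × Z → ℝ | IsConditionalPMF q} =>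
      mutualInfo (joint p₀ q.1) :=
    continuousOn_mutualInfo.comp_continuous hj hj0
  have hm : Continuous (marginalXZ : (X × Y × Z → ℝ) → X × Z → ℝ) := by
    refine continuous_pi fun s => ?_
    simp only [marginalXZ]
    fun_prop
  have hI₂ : Continuous fun q : {q : X → Y × Z → ℝ | IsConditionalPMF q} =>
      mutualInfo (marginalXZ (joint p₀ q.1)) :=
    continuousOn_mutualInfo.comp_continuous (hm.comp hj) fun q => marginalXZ_nonneg (hj0 q)
  have htv : Continuous fun q : {q : X → Y × Z → ℝ | IsConditionalPMF q} =>
      tv (joint p₀ p) (joint p₀ q.1) := by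
    have : Continuous fun P : X × Y × Z → ℝ => tv (joint p₀ p) P := by
      simp only [tv]
      fun_prop
    exact this.comp hj
  have hC : IsClosed {r : {q : X → Y × Z → ℝ | IsConditionalPMF q} × (ℝ × ℝ × ℝ) |
      tv (joint p₀ p) (joint p₀ r.1.1) ≤ r.2.2.2 ∧ mutualInfo (joint p₀ r.1.1) ≤ r.2.1 ∧
        mutualInfo (marginalXZ (joint p₀ r.1.1)) ≤ r.2.2.1} :=
    (isClosed_le (htv.comp continuous_fst) (by fun_prop)).inter
      ((isClosed_le (hI₁.comp continuous_fst) (by fun_prop)).inter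
        (isClosed_le (hI₂.comp continuous_fst) (by fun_prop)))
  have := isClosedMap_snd_of_compactSpace _ hC
  convert this using 1
  ext t
  constructor
  · rintro ⟨q, hq, hΔ, h1, h2⟩
    exact ⟨(⟨q, hq⟩, t), ⟨hΔ.2, h1, h2⟩, rfl⟩
  · rintro ⟨⟨⟨q, hq⟩, t⟩, ⟨hΔ, h1, h2⟩, rfl⟩
    exact ⟨q, hq, ⟨joint_mem_stdSimplex hp₀ hq, hΔ⟩, h1, h2⟩

variable [DecidableEq X] [DecidableEq Y] [DecidableEq Z]

lemma achievable_mem_testChannelRegion {p₀ : X → ℝ} (hp₀ : p₀ ∈ stdSimplex ℝ X)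
    {p : X → Y × Z → ℝ} (hp : IsConditionalPMF p) {R₁ R₂ Δ : ℝ}
    (h : Achievable p₀ p R₁ R₂ Δ) : (R₁, R₂, Δ) ∈ testChannelRegion p₀ p := by
  obtain ⟨N, hN⟩ := h
  -- One block length suffices: the bounds hold exactly at each `n`, with no limit.
  set n := N + 1
  have hn : 0 < n := N.succ_pos
  have hn' : (0 : ℝ) < n := by exact_mod_cast hn
  obtain ⟨c, hc⟩ := hN n N.lt_succ_self
  have hX : Nonempty X := by
    by_contra h
    rw [not_nonempty_iff] at h
    have := hp₀.2
    simp at this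
  set w₁ := fun u k => (c.decY u k, c.decZ (c.recode u) k)
  set P : X × Y × Z → ℝ := averageType p₀ fun x => w₁ (c.enc x) with hPdef
  have hP0 : ∀ s, 0 ≤ P s := averageType_nonneg hp₀ _
  have hfst : ∀ a, ∑ b, P (a, b) = p₀ a := sum_averageType_snd hp₀ hn _
  -- Letters of probability zero leave the conditional law undetermined; `p a` is a default that
  -- keeps `q` a channel.
  set q : X → Y × Z → ℝ := fun a => if p₀ a = 0 then p a else fun b => P (a, b) / p₀ a with hqdef
  have hq : IsConditionalPMF q := by
    intro a
    simp only [hqdef]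
    split_ifs with h0
    · exact hp a
    · refine ⟨fun b => div_nonneg (hP0 _) (hp₀.1 a), ?_⟩
      rw [← sum_div, hfst, div_self h0]
  have hjoint : joint p₀ q = P := by
    ext ⟨a, b⟩
    simp only [joint, hqdef]
    split_ifs with h0
    · have := le_marginal_fst hP0 a b
      rw [hfst, h0] at this
      rw [h0, zero_mul]
      exact le_antisymm (hP0 _) this
    · exact mul_div_cancel₀ _ h0
  have hmarg : marginalXZ P = averageType p₀ fun x => c.decZ (c.recode (c.enc x)) := by
    ext ⟨a, b⟩
    simp only [marginalXZ, hPdef, averageType]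
    rw [sum_comm]
    refine sum_congr rfl fun x _ => ?_
    rw [← mul_sum]
    congr 1
    simp only [empirical, ← mul_sum]
    rw [sum_comm]
    congr 1
    refine sum_congr rfl fun k _ => ?_
    simp only [w₁, Prod.mk.injEq]
    by_cases h1 : x k = a <;> by_cases h2 : c.decZ (c.recode (c.enc x)) k = b <;> simp [h1, h2]
  have hpos : 0 < messageCount n R₁ := (c.enc fun _ => Classical.arbitrary X).pos
  have hpos' : 0 < messageCount n R₂ := (c.recode (c.enc fun _ => Classical.arbitrary X)).pos
  refine ⟨q, hq, ⟨joint_mem_stdSimplex hp₀ hq, ?_⟩, ?_, ?_⟩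
  · rw [tv_comm, hjoint]
    exact (tv_sum_mul_le (prod_mem_stdSimplex hp₀ n)
      (fun x => empirical fun k => (x k, w₁ (c.enc x) k)) _).trans hc
  · rw [hjoint]
    have := (mutualInfo_averageType_le hp₀ hn c.enc w₁).trans (logb_messageCount_le hpos)
    exact le_of_mul_le_mul_left this hn'
  · rw [hjoint, hmarg]
    have := (mutualInfo_averageType_le hp₀ hn (fun x => c.recode (c.enc x)) c.decZ).trans
      (logb_messageCount_le hpos')
    exact le_of_mul_le_mul_left this hn'

end region

/-! ### Achievability: typical sequences, codebooks and codes. -/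

open Filter Topology

/-- The normalized logarithm of the product is the mean of `log ρ` under the type, hence close to
its mean under `P`. This supplies the density bounds needed for covering. -/
lemma prod_le_exp_of_tv_le {S : Type*} [DecidableEq S] [Fintype S] {n : ℕ} (hn : 0 < n)
    {P ρ : S → ℝ} {s : Fin n → S} (hρ : ∀ k, 0 < ρ (s k)) {η δ : ℝ}
    (htv : tv (empirical s) P ≤ η) (hδ : 2 * η * ∑ a, |log (ρ a)| ≤ δ) :
    ∏ k, ρ (s k) ≤ exp (n * (∑ a, P a * log (ρ a) + δ)) := by
  have hn' : (0 : ℝ) < n := by exact_mod_cast hn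
  rw [← log_le_iff_le_exp (prod_pos fun k _ => hρ k), log_prod fun k _ => (hρ k).ne']
  have h1 := sum_mul_sub_le_tv (empirical s) P fun a => log (ρ a)
  rw [sum_empirical_mul] at h1
  have h2 : 2 * tv (empirical s) P * ∑ a, |log (ρ a)| ≤ 2 * η * ∑ a, |log (ρ a)| := by
    gcongr
  have h3 : 1 / (n : ℝ) * ∑ k, log (ρ (s k)) ≤ ∑ a, P a * log (ρ a) + δ := by linarith
  rwa [one_div, inv_mul_le_iff₀ hn'] at h3

lemma sum_pi_triple {X Y Z : Type*} [Fintype X] [Fintype Y] [Fintype Z] {n : ℕ}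
    (F : (Fin n → X × Y × Z) → ℝ) :
    ∑ s, F s = ∑ u : Fin n → X, ∑ v : Fin n → Y, ∑ w : Fin n → Z, F fun k => (u k, v k, w k) := by
  rw [← (Equiv.arrowProdEquivProdArrow (Fin n) (fun _ => X) (fun _ => Y × Z)).symm.sum_comp,
    Fintype.sum_prod_type]
  refine sum_congr rfl fun u _ => ?_
  rw [← (Equiv.arrowProdEquivProdArrow (Fin n) (fun _ => Y) (fun _ => Z)).symm.sum_comp,
    Fintype.sum_prod_type]
  rfl

lemma sum_marginalXZ_snd {X Y Z : Type*} [Fintype Y] [Fintype Z] (P : X × Y × Z → ℝ) (x : X) :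
    ∑ z, marginalXZ P (x, z) = ∑ b, P (x, b) := by
  rw [Fintype.sum_prod_type_right]
  rfl

lemma sum_marginalXZ_fst {X Y Z : Type*} [Fintype X] [Fintype Y] (P : X × Y × Z → ℝ) (z : Z) :
    ∑ x, marginalXZ P (x, z) = ∑ y, ∑ x, P (x, y, z) := by
  rw [sum_comm]
  rfl

lemma le_marginalXZ {X Y Z : Type*} [Fintype Y] {P : X × Y × Z → ℝ} (hP : ∀ s, 0 ≤ P s)
    (s : X × Y × Z) : P s ≤ marginalXZ P (s.1, s.2.2) :=
  single_le_sum (f := fun y => P (s.1, y, s.2.2)) (fun _ _ => hP _) (mem_univ s.2.1)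

section codebook

variable {X Y Z : Type*} [Fintype X] [Fintype Y] [Fintype Z]

/-- The likelihood ratio whose expected logarithm is `I(X; Z)`. -/
noncomputable def ratioXZ (P : X × Y × Z → ℝ) (s : X × Y × Z) : ℝ :=
  marginalXZ P (s.1, s.2.2) / ((∑ b, P (s.1, b)) * ∑ x, marginalXZ P (x, s.2.2))

/-- The likelihood ratio whose expected logarithm is `I(X; Y | Z)`. -/
noncomputable def ratioXYgivenZ (P : X × Y × Z → ℝ) (s : X × Y × Z) : ℝ :=
  P s / (marginalXZ P (s.1, s.2.2) * (∑ x, P (x, s.2)) / ∑ x, marginalXZ P (x, s.2.2))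

variable {P : X × Y × Z → ℝ}

lemma marginals_pos (hP : ∀ s, 0 ≤ P s) {s : X × Y × Z} (hs : 0 < P s) :
    0 < marginalXZ P (s.1, s.2.2) ∧ 0 < ∑ b, P (s.1, b) ∧ 0 < ∑ x, P (x, s.2) ∧
      0 < ∑ x, marginalXZ P (x, s.2.2) := by
  have h := hs.trans_le (le_marginalXZ hP s)
  exact ⟨h, hs.trans_le (le_marginal_fst hP s.1 s.2), hs.trans_le (le_marginal_snd hP s.1 s.2),
    h.trans_le (le_marginal_snd (marginalXZ_nonneg hP) s.1 s.2.2)⟩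

lemma ratioXZ_pos (hP : ∀ s, 0 ≤ P s) {s : X × Y × Z} (hs : 0 < P s) : 0 < ratioXZ P s := by
  obtain ⟨h1, h2, h3, h4⟩ := marginals_pos hP hs
  exact div_pos h1 (mul_pos h2 h4)

lemma ratioXYgivenZ_pos (hP : ∀ s, 0 ≤ P s) {s : X × Y × Z} (hs : 0 < P s) :
    0 < ratioXYgivenZ P s := by
  obtain ⟨h1, h2, h3, h4⟩ := marginals_pos hP hs
  exact div_pos hs (div_pos (mul_pos h1 h3) h4)

lemma sum_mul_log_ratioXZ (P : X × Y × Z → ℝ) :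
    ∑ s, P s * log (ratioXZ P s) = mutualInfo (marginalXZ P) * log 2 := by
  rw [mutualInfo_mul_log_two, Fintype.sum_prod_type, Fintype.sum_prod_type]
  refine sum_congr rfl fun x _ => ?_
  rw [Fintype.sum_prod_type_right]
  refine sum_congr rfl fun z _ => ?_
  simp only [ratioXZ, sum_marginalXZ_snd]
  rw [← sum_mul]
  rfl

lemma sum_mul_log_ratioXYgivenZ (hP : ∀ s, 0 ≤ P s) :
    ∑ s, P s * log (ratioXYgivenZ P s) =
      mutualInfo P * log 2 - mutualInfo (marginalXZ P) * log 2 := by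
  rw [← sum_mul_log_ratioXZ, mutualInfo_mul_log_two, ← sum_sub_distrib]
  refine sum_congr rfl fun s _ => ?_
  rcases (hP s).eq_or_lt with h0 | hpos
  · simp [← h0]
  · obtain ⟨h1, h2, h3, h4⟩ := marginals_pos hP hpos
    rw [← mul_sub, ← log_div (div_pos hpos (mul_pos h2 h3)).ne' (ratioXZ_pos hP hpos).ne']
    congr 2
    unfold ratioXYgivenZ ratioXZ
    field_simp

/-- The difference is `I(X;Y|Z)`, the relative entropy of `P` with respect to the law making `X` and
`Y` independent given `Z`; Gibbs' inequality applies. -/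
lemma mutualInfo_marginalXZ_le (hP : ∀ s, 0 ≤ P s) :
    mutualInfo (marginalXZ P) ≤ mutualInfo P := by
  have h2 : 0 < log 2 := log_pos one_lt_two
  refine le_of_mul_le_mul_right (sub_nonneg.1 ?_) h2
  rw [← sum_mul_log_ratioXYgivenZ hP]
  have hZ0 : ∀ z, 0 ≤ ∑ x, marginalXZ P (x, z) := fun z =>
    sum_nonneg fun _ _ => marginalXZ_nonneg hP _
  refine sum_mul_log_div_nonneg hP (fun s => ?_) (fun s hs => ?_) ?_
  · exact div_nonneg (mul_nonneg (marginalXZ_nonneg hP _) (sum_nonneg fun _ _ => hP _)) (hZ0 _)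
  · obtain ⟨h1, h2, h3, h4⟩ := marginals_pos hP hs
    exact div_pos (mul_pos h1 h3) h4
  · rw [Fintype.sum_prod_type_right, Fintype.sum_prod_type_right P, Fintype.sum_prod_type_right,
      Fintype.sum_prod_type_right]
    refine sum_le_sum fun z _ => le_of_eq ?_
    simp_rw [← sum_div, ← sum_mul, ← mul_sum, ← sum_marginalXZ_fst]
    exact mul_self_div_self _

variable [DecidableEq X] [DecidableEq Y] [DecidableEq Z]

open Classical in
/-- Codebooks of rates slightly above `I(X; Z)` and `I(X; Y | Z)` cover typical sequences. -/
lemma exists_codebooks (hP : P ∈ stdSimplex ℝ (X × Y × Z)) {η δ : ℝ} (hη : 0 < η)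
    (hδ₁ : 2 * η * ∑ s, |log (ratioXYgivenZ P s)| ≤ δ) (hδ₂ : 2 * η * ∑ s, |log (ratioXZ P s)| ≤ δ)
    {n : ℕ} (hn : 0 < n) (K M : ℕ) :
    ∃ (cz : Fin M → Fin n → Z) (cy : (Fin n → Z) → Fin K → Fin n → Y),
      ∑ u : Fin n → X, (∏ k, ∑ b, P (u k, b)) *
        (if ∃ j i, tv (jointType u (cy (cz j) i) (cz j)) P ≤ η then 0 else 1) ≤
      Fintype.card (X × Y × Z) / √n / η +
        exp (-(K / exp (n * (mutualInfo P * log 2 - mutualInfo (marginalXZ P) * log 2 + δ)))) +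
        exp (-(M / exp (n * (mutualInfo (marginalXZ P) * log 2 + δ)))) := by
  -- Positive probability is required along with typicality, so that every likelihood ratio along
  -- the sequence is positive.
  obtain ⟨T, hT⟩ : ∃ T : (Fin n → X) → (Fin n → Y) → (Fin n → Z) → Prop, ∀ u v w,
      T u v w ↔ 0 < ∏ k, P (u k, v k, w k) ∧ tv (jointType u v w) P ≤ η :=
    ⟨_, fun _ _ _ => Iff.rfl⟩
  have hprod : ∀ s : Fin n → X × Y × Z, 0 ≤ ∏ k, P (s k) := fun s =>
    prod_nonneg fun k _ => hP.1 _
  have hTk : ∀ u v w, T u v w → ∀ k, 0 < P (u k, v k, w k) := fun u v w h k =>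
    (hP.1 _).lt_of_ne' fun h0 => ((hT u v w).1 h).1.ne' (prod_eq_zero (mem_univ k) h0)
  have mXZ : ∀ (u : Fin n → X) (w : Fin n → Z),
      ∑ v : Fin n → Y, ∏ k, P (u k, v k, w k) = ∏ k, marginalXZ P (u k, w k) := fun u w =>
    sum_pi_prod fun k y => P (u k, y, w k)
  have mYZ : ∀ (v : Fin n → Y) (w : Fin n → Z),
      ∑ u : Fin n → X, ∏ k, P (u k, v k, w k) = ∏ k, ∑ x, P (x, v k, w k) := fun v w =>
    sum_pi_prod fun k x => P (x, v k, w k)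
  have mZ : ∀ w : Fin n → Z, ∑ u : Fin n → X, ∑ v : Fin n → Y, ∏ k, P (u k, v k, w k) =
      ∏ k, ∑ x, marginalXZ P (x, w k) := fun w => by
    simp_rw [mXZ]
    exact sum_pi_prod fun k x => marginalXZ P (x, w k)
  have mX : ∀ u : Fin n → X, ∑ v : Fin n → Y, ∑ w : Fin n → Z, ∏ k, P (u k, v k, w k) =
      ∏ k, ∑ b, P (u k, b) := fun u => by
    rw [sum_comm]
    simp_rw [mXZ]
    rw [sum_pi_prod fun k z => marginalXZ P (u k, z)]
    simp_rw [sum_marginalXZ_snd]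
  have hsum : ∑ u : Fin n → X, ∑ v : Fin n → Y, ∑ w : Fin n → Z,
      ∏ k, P (u k, v k, w k) = 1 := by
    rw [← sum_pi_triple fun s => ∏ k, P (s k)]
    exact (prod_mem_stdSimplex hP n).2
  have hY : Nonempty (Fin n → Y) := by
    by_contra h
    rw [not_nonempty_iff] at h
    simp at hsum
  obtain ⟨cz, cy, hc⟩ := exists_superposition_covering
    (P := fun (u : Fin n → X) (v : Fin n → Y) (w : Fin n → Z) => ∏ k, P (u k, v k, w k))
    (fun u v w => hprod fun k => (u k, v k, w k)) hsum (S := T)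
    (exp_pos (n * (mutualInfo P * log 2 - mutualInfo (marginalXZ P) * log 2 + δ)))
    (exp_pos (n * (mutualInfo (marginalXZ P) * log 2 + δ)))
    (fun u v w h => by
      have h1 := prod_le_exp_of_tv_le hn (s := fun k => (u k, v k, w k))
        (fun k => ratioXYgivenZ_pos hP.1 (hTk u v w h k)) ((hT u v w).1 h).2 hδ₁
      rw [sum_mul_log_ratioXYgivenZ hP.1] at h1
      rw [mZ, mXZ, mYZ, mul_assoc, ← prod_mul_distrib, ← prod_mul_distrib]
      refine le_trans (le_of_eq ?_) (mul_le_mul_of_nonneg_right h1 (prod_nonneg fun k _ =>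
        mul_nonneg (marginalXZ_nonneg hP.1 _) (sum_nonneg fun _ _ => hP.1 _)))
      rw [← prod_mul_distrib]
      refine prod_congr rfl fun k _ => ?_
      obtain ⟨h1, h2, h3, h4⟩ := marginals_pos hP.1 (hTk u v w h k)
      simp only [ratioXYgivenZ]
      simp only at h1 h2 h3 h4
      field_simp)
    (fun u v w h => by
      have h1 := prod_le_exp_of_tv_le hn (s := fun k => (u k, v k, w k))
        (fun k => ratioXZ_pos hP.1 (hTk u v w h k)) ((hT u v w).1 h).2 hδ₂
      rw [sum_mul_log_ratioXZ] at h1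
      rw [mZ, mXZ, mX, mul_assoc, ← prod_mul_distrib]
      refine le_trans (le_of_eq ?_) (mul_le_mul_of_nonneg_right h1 (prod_nonneg fun k _ =>
        mul_nonneg (sum_nonneg fun _ _ => hP.1 _)
          (sum_nonneg fun _ _ => marginalXZ_nonneg hP.1 _)))
      rw [← prod_mul_distrib]
      refine prod_congr rfl fun k _ => ?_
      obtain ⟨h1, h2, h3, h4⟩ := marginals_pos hP.1 (hTk u v w h k)
      simp only [ratioXZ]
      simp only at h1 h2 h3 h4
      field_simp)
    K M hY
  refine ⟨cz, cy, ?_⟩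
  -- Markov's inequality for the distance between the type and `P`; triples of probability zero
  -- contribute nothing.
  have hatyp : ∑ u : Fin n → X, ∑ v : Fin n → Y, ∑ w : Fin n → Z,
      (∏ k, P (u k, v k, w k)) * (if T u v w then 0 else 1) ≤
      Fintype.card (X × Y × Z) / √n / η := by
    rw [le_div_iff₀ hη]
    refine le_trans ?_ (sum_prod_mul_tv_empirical_le hn hP)
    rw [sum_pi_triple fun s => (∏ m, P (s m)) * tv (empirical s) P, sum_mul]
    refine sum_le_sum fun u _ => ?_
    rw [sum_mul]
    refine sum_le_sum fun v _ => ?_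
    rw [sum_mul]
    refine sum_le_sum fun w _ => ?_
    have h0 := hprod fun k => (u k, v k, w k)
    have ht := tv_nonneg (jointType u v w) P
    split_ifs with h
    · rw [mul_zero, zero_mul]
      exact mul_nonneg h0 ht
    · rw [mul_one]
      rcases h0.eq_or_lt with h0 | hpos
      · rw [← h0, zero_mul, zero_mul]
      · refine mul_le_mul_of_nonneg_left
          (le_of_not_ge fun h' => h ((hT u v w).2 ⟨hpos, h'⟩)) hpos.le
  simp_rw [mX] at hc
  refine (le_trans (sum_le_sum fun u _ => mul_le_mul_of_nonneg_left ?_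
    (prod_nonneg fun k _ => sum_nonneg fun _ _ => hP.1 _)) hc).trans (by linarith)
  by_cases h : ∃ j i, T u (cy (cz j) i) (cz j)
  · have h' : ∃ j i, tv (jointType u (cy (cz j) i) (cz j)) P ≤ η := by
      obtain ⟨j, i, hji⟩ := h
      exact ⟨j, i, ((hT _ _ _).1 hji).2⟩
    rw [if_pos h, if_pos h']
  · rw [if_neg h]
    split_ifs <;> norm_num

open Classical in
/-- A pair of codebooks gives a coordination code whose expected distortion is controlled by the
weight of the uncovered source sequences. -/
lemma exists_code_of_codebooks {p₀ : X → ℝ} (hp₀ : p₀ ∈ stdSimplex ℝ X)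
    (hP : P ∈ stdSimplex ℝ (X × Y × Z)) {η : ℝ} (hη : 0 ≤ η) {n : ℕ} (hn : 0 < n)
    {K M M₁ M₂ : ℕ} (hK : 0 < K) (hM : 0 < M) (hM₁ : M * K ≤ M₁) (hM₂ : M ≤ M₂)
    (cz : Fin M → Fin n → Z) (cy : (Fin n → Z) → Fin K → Fin n → Y) :
    ∃ c : CoordinationCode X Y Z M₁ M₂ n, expectedDistortion p₀ P c ≤
      η + ∑ u : Fin n → X, (∏ k, p₀ (u k)) *
        (if ∃ j i, tv (jointType u (cy (cz j) i) (cz j)) P ≤ η then 0 else 1) := by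
  -- Index pairs are embedded in the first message set and the index of `z` in the second. The
  -- middle node decodes the pair and forwards its first component.
  obtain ⟨e₁⟩ := Function.Embedding.nonempty_of_card_le
    (α := Fin M × Fin K) (β := Fin M₁) (by simpa using hM₁)
  have : Nonempty (Fin M × Fin K) := ⟨(⟨0, hM⟩, ⟨0, hK⟩)⟩
  have : Nonempty (Fin M) := ⟨⟨0, hM⟩⟩
  set e₂ : Fin M → Fin M₂ := Fin.castLE hM₂ with he₂
  have hinv₁ : ∀ m, Function.invFun e₁ (e₁ m) = m := Function.leftInverse_invFun e₁.injective
  have hinv₂ : ∀ m, Function.invFun e₂ (e₂ m) = m :=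
    Function.leftInverse_invFun (Fin.castLE_injective hM₂)
  have hsel : ∀ u : Fin n → X, ∃ m : Fin M × Fin K,
      (∃ j i, tv (jointType u (cy (cz j) i) (cz j)) P ≤ η) →
        tv (jointType u (cy (cz m.1) m.2) (cz m.1)) P ≤ η := by
    intro u
    by_cases h : ∃ j i, tv (jointType u (cy (cz j) i) (cz j)) P ≤ η
    · obtain ⟨j, i, hji⟩ := h
      exact ⟨(j, i), fun _ => hji⟩
    · exact ⟨Classical.arbitrary _, fun h' => absurd h' h⟩
  choose sel hsel using hsel
  refine ⟨⟨fun u => e₁ (sel u), fun m => e₂ (Function.invFun e₁ m).1,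
    fun m => cy (cz (Function.invFun e₁ m).1) (Function.invFun e₁ m).2,
    fun m => cz (Function.invFun e₂ m)⟩, ?_⟩
  have hη' : η = ∑ u : Fin n → X, (∏ k, p₀ (u k)) * η := by
    rw [← sum_mul, (prod_mem_stdSimplex hp₀ n).2, one_mul]
  rw [hη', expectedDistortion, ← sum_add_distrib, ← hη']
  refine sum_le_sum fun u _ => ?_
  rw [← mul_add]
  refine mul_le_mul_of_nonneg_left ?_ (prod_nonneg fun k _ => hp₀.1 _)
  simp only [hinv₁, hinv₂]
  split_ifs with h
  · rw [add_zero]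
    exact hsel u h
  · refine (tv_le_one ?_ hP).trans (by linarith)
    exact empirical_mem_stdSimplex hn _

lemma half_le_floor {x : ℝ} (hx : 1 ≤ x) : x / 2 ≤ ⌊x⌋₊ := by
  have h1 := Nat.lt_floor_add_one x
  have h2 : (1 : ℝ) ≤ ⌊x⌋₊ := by exact_mod_cast Nat.one_le_floor_iff x |>.2 hx
  linarith

/-- Rates strictly above the mutual informations suffice for empirical coordination. -/
lemma exists_code {p₀ : X → ℝ} (hp₀ : p₀ ∈ stdSimplex ℝ X) {q : X → Y × Z → ℝ}
    (hq : IsConditionalPMF q) {R₁ R₂ ε : ℝ} (h₁ : mutualInfo (joint p₀ q) < R₁)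
    (h₂ : mutualInfo (marginalXZ (joint p₀ q)) < R₂) (hε : 0 < ε) :
    Achievable p₀ q R₁ R₂ ε := by
  have hl : 0 < log 2 := log_pos one_lt_two
  have hP := joint_mem_stdSimplex hp₀ hq
  set P := joint p₀ q with hPdef
  have hPX : ∀ x, ∑ b, P (x, b) = p₀ x := fun x => by
    simp only [hPdef, joint, ← mul_sum, (hq _).2, mul_one]
  have hI₂ : 0 ≤ mutualInfo (marginalXZ P) := by
    refine mutualInfo_nonneg ⟨marginalXZ_nonneg hP.1, ?_⟩
    rw [Fintype.sum_prod_type]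
    simp_rw [sum_marginalXZ_snd, hPX, hp₀.2]
  have hI₁ := mutualInfo_marginalXZ_le hP.1
  set J₂ := mutualInfo (marginalXZ P) * log 2 with hJ₂
  set J₁ := mutualInfo P * log 2 - J₂ with hJ₁
  have hJ₂0 : 0 ≤ J₂ := mul_nonneg hI₂ hl.le
  have hJ₁0 : 0 ≤ J₁ := sub_nonneg.2 (mul_le_mul_of_nonneg_right hI₁ hl.le)
  -- Each codebook gets exponent slack `2 * δ`: one `δ` pays for typicality, the other makes
  -- coverage succeed. The first link carries both indices, hence `4 * δ`.
  obtain ⟨δ, hδ, hδ₁, hδ₂⟩ : ∃ δ > 0, J₁ + J₂ + 4 * δ ≤ R₁ * log 2 ∧ J₂ + 2 * δ ≤ R₂ * log 2 := by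
    have e1 := mul_pos (sub_pos.2 h₁) hl
    have e2 := mul_pos (sub_pos.2 h₂) hl
    refine ⟨min ((R₁ - mutualInfo P) * log 2 / 4) ((R₂ - mutualInfo (marginalXZ P)) * log 2 / 2),
      lt_min (by linarith) (by linarith), ?_, ?_⟩
    · have := min_le_left ((R₁ - mutualInfo P) * log 2 / 4)
        ((R₂ - mutualInfo (marginalXZ P)) * log 2 / 2)
      linarith
    · have := min_le_right ((R₁ - mutualInfo P) * log 2 / 4)
        ((R₂ - mutualInfo (marginalXZ P)) * log 2 / 2)
      linarith
  set C := ∑ s, |log (ratioXYgivenZ P s)| + ∑ s, |log (ratioXZ P s)| + 1 with hC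
  have hC₁ : 0 ≤ ∑ s, |log (ratioXYgivenZ P s)| := sum_nonneg fun _ _ => abs_nonneg _
  have hC₂ : 0 ≤ ∑ s, |log (ratioXZ P s)| := sum_nonneg fun _ _ => abs_nonneg _
  have hC0 : 0 < C := by linarith
  obtain ⟨η, hη, hηε, hηδ⟩ : ∃ η > 0, η ≤ ε / 2 ∧ 2 * η * C ≤ δ := by
    refine ⟨min (ε / 2) (δ / (2 * C)), lt_min (by linarith) (by positivity), min_le_left _ _, ?_⟩
    have := min_le_right (ε / 2) (δ / (2 * C))
    rw [le_div_iff₀ (by positivity)] at this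
    linarith
  have hη₁ : 2 * η * ∑ s, |log (ratioXYgivenZ P s)| ≤ δ :=
    (mul_le_mul_of_nonneg_left (by linarith) (by linarith)).trans hηδ
  have hη₂ : 2 * η * ∑ s, |log (ratioXZ P s)| ≤ δ :=
    (mul_le_mul_of_nonneg_left (by linarith) (by linarith)).trans hηδ
  have hlim : Tendsto (fun n : ℕ => (Fintype.card (X × Y × Z) : ℝ) / √n / η +
      exp (-(exp (n * δ) / 2)) + exp (-(exp (n * δ) / 2))) atTop (𝓝 0) := by
    have t1 : Tendsto (fun n : ℕ => (Fintype.card (X × Y × Z) : ℝ) / √n / η) atTop (𝓝 0) := by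
      have := ((tendsto_sqrt_atTop.comp tendsto_natCast_atTop_atTop).const_div_atTop
        (Fintype.card (X × Y × Z) : ℝ)).div_const η
      simpa using this
    have t2 : Tendsto (fun n : ℕ => exp (-(exp (n * δ) / 2))) atTop (𝓝 0) :=
      tendsto_exp_neg_atTop_nhds_zero.comp ((tendsto_exp_atTop.comp
        (tendsto_natCast_atTop_atTop.atTop_mul_const hδ)).atTop_div_const two_pos)
    simpa using (t1.add t2).add t2
  obtain ⟨N, hN⟩ := eventually_atTop.1 (hlim.eventually (ge_mem_nhds (half_pos hε)))
  refine ⟨N, fun n hn => ?_⟩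
  have hn0 : 0 < n := by omega
  set K := ⌊exp (n * (J₁ + 2 * δ))⌋₊ with hKdef
  set M := ⌊exp (n * (J₂ + 2 * δ))⌋₊ with hMdef
  have hx₁ : 1 ≤ exp (n * (J₁ + 2 * δ)) := one_le_exp (by positivity)
  have hx₂ : 1 ≤ exp (n * (J₂ + 2 * δ)) := one_le_exp (by positivity)
  have hK : 0 < K := Nat.floor_pos.2 hx₁
  have hM : 0 < M := Nat.floor_pos.2 hx₂
  have hrpow : ∀ R : ℝ, (2 : ℝ) ^ ((n : ℝ) * R) = exp (n * (R * log 2)) := fun R => by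
    rw [rpow_def_of_pos two_pos]
    congr 1
    ring
  have hM₁ : M * K ≤ messageCount n R₁ := by
    refine Nat.le_floor ?_
    rw [hrpow, Nat.cast_mul]
    calc (M : ℝ) * K ≤ exp (n * (J₂ + 2 * δ)) * exp (n * (J₁ + 2 * δ)) :=
          mul_le_mul (Nat.floor_le (exp_pos _).le) (Nat.floor_le (exp_pos _).le)
            (Nat.cast_nonneg _) (exp_pos _).le
      _ = exp (n * (J₁ + J₂ + 4 * δ)) := by rw [← exp_add]; congr 1; ring
      _ ≤ _ := by gcongr
  have hM₂ : M ≤ messageCount n R₂ := by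
    refine Nat.floor_le_floor ?_
    rw [hrpow]
    gcongr
  obtain ⟨cz, cy, hcov⟩ := exists_codebooks hP hη hη₁ hη₂ hn0 K M
  obtain ⟨c, hc⟩ := exists_code_of_codebooks hp₀ hP hη.le hn0 hK hM hM₁ hM₂ cz cy
  refine ⟨c, hc.trans ?_⟩
  simp_rw [hPX] at hcov
  -- The codebook size exceeds the covering threshold by the factor `exp (n * δ)`, up to a factor of
  -- two lost to the floor.
  have hexp : ∀ J : ℝ, 1 ≤ exp (n * (J + 2 * δ)) →
      exp (-(⌊exp (n * (J + 2 * δ))⌋₊ / exp (n * (J + δ)))) ≤ exp (-(exp (n * δ) / 2)) := by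
    intro J hJ
    rw [exp_le_exp, neg_le_neg_iff, le_div_iff₀ (exp_pos _)]
    refine le_trans (le_of_eq ?_) (half_le_floor hJ)
    rw [div_mul_eq_mul_div, ← exp_add]
    congr 2
    ring
  have b1 := hexp J₁ hx₁
  have b2 := hexp J₂ hx₂
  have b3 := hN n hn.le
  linarith

/-- A code that coordinates `q` within the slack left in `Δ` also serves `p`, by the triangle
inequality under the source law. -/
lemma achievable_of_lt {p₀ : X → ℝ} (hp₀ : p₀ ∈ stdSimplex ℝ X) (p : X → Y × Z → ℝ)
    {q : X → Y × Z → ℝ} (hq : IsConditionalPMF q) {R₁ R₂ Δ : ℝ}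
    (h₁ : mutualInfo (joint p₀ q) < R₁) (h₂ : mutualInfo (marginalXZ (joint p₀ q)) < R₂)
    (hΔ : tv (joint p₀ p) (joint p₀ q) < Δ) : Achievable p₀ p R₁ R₂ Δ := by
  obtain ⟨N, hN⟩ := exists_code hp₀ hq h₁ h₂ (sub_pos.2 hΔ)
  refine ⟨N, fun n hn => ?_⟩
  obtain ⟨c, hc⟩ := hN n hn
  refine ⟨c, ?_⟩
  have h : expectedDistortion p₀ (joint p₀ p) c ≤
      expectedDistortion p₀ (joint p₀ q) c + tv (joint p₀ p) (joint p₀ q) := by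
    have e : tv (joint p₀ p) (joint p₀ q) =
        ∑ x : Fin n → X, (∏ k, p₀ (x k)) * tv (joint p₀ p) (joint p₀ q) := by
      rw [← sum_mul, (prod_mem_stdSimplex hp₀ n).2, one_mul]
    rw [e, expectedDistortion, expectedDistortion, ← sum_add_distrib]
    refine sum_le_sum fun x _ => ?_
    rw [← mul_add]
    refine mul_le_mul_of_nonneg_left ?_ (prod_nonneg fun k _ => hp₀.1 _)
    rw [tv_comm (joint p₀ p)]
    exact tv_triangle _ _ _
  linarith

end codebook

end CascadeCoordination

theorem lemma4 {X Y Z : Type*} [Fintype X] [Fintype Y] [Fintype Z]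
    [DecidableEq X] [DecidableEq Y] [DecidableEq Z]
    (p₀ : X → ℝ) (hp₀ : p₀ ∈ stdSimplex ℝ X)
    (p : X → Y × Z → ℝ) (hp : CascadeCoordination.IsConditionalPMF p) :
    CascadeCoordination.rateDistortionRegion p₀ p =
      {t : ℝ × ℝ × ℝ | ∃ q : X → Y × Z → ℝ,
        CascadeCoordination.IsConditionalPMF q ∧
        CascadeCoordination.joint p₀ q ∈
          CascadeCoordination.deltaNeighborhood t.2.2 (CascadeCoordination.joint p₀ p) ∧
        CascadeCoordination.mutualInfo (CascadeCoordination.joint p₀ q) ≤ t.1 ∧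
        CascadeCoordination.mutualInfo
          (CascadeCoordination.marginalXZ (CascadeCoordination.joint p₀ q)) ≤ t.2.1} := by
  refine Set.Subset.antisymm (closure_minimal (fun t ht =>
    CascadeCoordination.achievable_mem_testChannelRegion hp₀ hp ht)
    (CascadeCoordination.isClosed_testChannelRegion hp₀ p)) ?_
  rintro ⟨R₁, R₂, Δ⟩ ⟨q, hq, ⟨-, hΔ⟩, h₁, h₂⟩
  -- Coding needs strict inequalities, so all three coordinates are raised by `1 / (n + 1)` and the
  -- given triple is reached as a limit.
  have hshift : Filter.Tendsto (fun n : ℕ => (1 : ℝ) / ((n : ℝ) + 1)) Filter.atTop (nhds 0) :=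
    tendsto_one_div_add_atTop_nhds_zero_nat
  have hlim : Filter.Tendsto (fun n : ℕ => (R₁ + 1 / ((n : ℝ) + 1), R₂ + 1 / ((n : ℝ) + 1),
      Δ + 1 / ((n : ℝ) + 1))) Filter.atTop (nhds (R₁, R₂, Δ)) := by
    refine Filter.Tendsto.prodMk_nhds ?_ (Filter.Tendsto.prodMk_nhds ?_ ?_) <;>
      simpa using hshift.const_add _
  refine mem_closure_of_tendsto hlim (Filter.Eventually.of_forall fun n => ?_)
  have hpos : (0 : ℝ) < 1 / ((n : ℝ) + 1) := by positivity
  exact CascadeCoordination.achievable_of_lt hp₀ p hq (h₁.trans_lt (lt_add_of_pos_right _ hpos))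
    (h₂.trans_lt (lt_add_of_pos_right _ hpos)) (hΔ.trans_lt (lt_add_of_pos_right _ hpos))
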